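/- Let $(M,g)$ be a connected finite-dimensional smooth Riemannian manifold (without boundary). Call $(M,g)$ a geodesic orbit manifold if every geodesic of $M$ is an orbit of a one-parameter subgroup of the full isometry group of $(M,g)$, i.e. every geodesic $\gamma:J\to M$ on an open interval $J$ has the form $\gamma(t)=\varphi_t(p)$, $t\in J$, for some smooth one-parameter group $(\varphi_t)_{t\in\mathbb{R}}$ of isometries of $(M,g)$ and some $p\in M$. Let $\mathfrak{g}$ be the Lie algebra of all Killing fields on $(M,g)$, i.e. of all smooth vector fields $X$ with $\mathcal{L}_Xg=0$, with the Lie bracket of vector fields. Theorem. Suppose that $(M,g)$ is a geodesic orbit manifold and that $\mathfrak{a}$ is an abelian ideal of $\mathfrak{g}$. Then every $X\in\mathfrak{a}$ has constant length on $M$: the function $x\mapsto \sqrt{g_x(X(x),X(x))}$ is constant. -/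

import Mathlib

open scoped Manifold ContDiff Bundle
open VectorField Bundle

noncomputable section

namespace GOManifold

section LieAlgebraOfVectorFields

variable (E : Type*) [NormedAddCommGroup E] [NormedSpace ℝ E] [FiniteDimensional ℝ E]
  (M : Type*) [TopologicalSpace M] [ChartedSpace E M] [IsManifold 𝓘(ℝ, E) ∞ M]

/-- The smooth vector fields on a smooth manifold `M` without boundary, modelled on the
finite-dimensional real vector space `E`. -/
abbrev SmoothVectorField : Type _ :=
  Cₛ^∞⟮𝓘(ℝ, E); E, (TangentSpace 𝓘(ℝ, E) : M → Type _)⟯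

variable {E M}

set_option linter.unusedSectionVars false in
theorem SmoothVectorField.mdiff (X : SmoothVectorField E M) (x : M) :
    MDifferentiableAt 𝓘(ℝ, E) (𝓘(ℝ, E).prod 𝓘(ℝ, E))
      (fun y ↦ (X y : TangentBundle 𝓘(ℝ, E) M)) x :=
  (X.contMDiff x).mdifferentiableAt (by simp)

theorem contMDiff_mlieBracket (X Y : SmoothVectorField E M) :
    ContMDiff 𝓘(ℝ, E) (𝓘(ℝ, E).prod 𝓘(ℝ, E)) ∞
      (fun x ↦ (mlieBracket 𝓘(ℝ, E) X Y x : TangentBundle 𝓘(ℝ, E) M)) := by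
  have : CompleteSpace E := FiniteDimensional.complete ℝ E
  have : IsManifold 𝓘(ℝ, E) (((⊤ : ℕ∞) : WithTop ℕ∞) + 1) M := by
    simpa using (inferInstance : IsManifold 𝓘(ℝ, E) ∞ M)
  have : IsManifold 𝓘(ℝ, E) (minSmoothness ℝ 2) M := by
    rw [minSmoothness_of_isRCLikeNormedField]; infer_instance
  have : IsManifold 𝓘(ℝ, E) (minSmoothness ℝ 3) M := by
    rw [minSmoothness_of_isRCLikeNormedField]; infer_instance
  exact ContDiff.mlieBracket_vectorField (m := ⊤) (n := ⊤) X.contMDiff Y.contMDiff (by simp)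

/-- The Lie bracket of smooth vector fields. -/
instance : Bracket (SmoothVectorField E M) (SmoothVectorField E M) where
  bracket X Y := ⟨mlieBracket 𝓘(ℝ, E) X Y, contMDiff_mlieBracket X Y⟩

theorem coe_lie (X Y : SmoothVectorField E M) :
    (⁅X, Y⁆ : SmoothVectorField E M) = mlieBracket 𝓘(ℝ, E) X Y := rfl

instance : LieRing (SmoothVectorField E M) where
  add_lie X Y Z := by
    ext x
    exact mlieBracket_add_left (X.mdiff x) (Y.mdiff x)
  lie_add X Y Z := by
    ext x
    exact mlieBracket_add_right (Y.mdiff x) (Z.mdiff x)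
  lie_self X := by
    ext x
    simp [coe_lie]
  leibniz_lie X Y Z := by
    have : CompleteSpace E := FiniteDimensional.complete ℝ E
    have : IsManifold 𝓘(ℝ, E) (minSmoothness ℝ 3) M := by
      rw [minSmoothness_of_isRCLikeNormedField]; infer_instance
    ext x
    have h (W : SmoothVectorField E M) := (W.contMDiff.of_le
      (show minSmoothness ℝ 2 ≤ ∞ by
        rw [minSmoothness_of_isRCLikeNormedField]; exact WithTop.coe_le_coe.2 le_top)) x
    exact leibniz_identity_mlieBracket_apply (h X) (h Y) (h Z)

instance : LieAlgebra ℝ (SmoothVectorField E M) where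
  lie_smul c X Y := by
    ext x
    exact mlieBracket_const_smul_right (Y.mdiff x)

end LieAlgebraOfVectorFields

section Commutator

variable {E : Type*} [NormedAddCommGroup E] [NormedSpace ℝ E] [FiniteDimensional ℝ E]
  {M : Type*} [TopologicalSpace M] [ChartedSpace E M] [IsManifold 𝓘(ℝ, E) ∞ M]

theorem lie_smul_function (X W : SmoothVectorField E M) {f h : M → ℝ}
    (hf : MDifferentiable 𝓘(ℝ, E) 𝓘(ℝ, ℝ) f)
    (hXf : ∀ x, mvfderiv 𝓘(ℝ, E) f x (X x) = h x) :
    mlieBracket 𝓘(ℝ, E) X (f • W) = h • (W : ∀ x, TangentSpace 𝓘(ℝ, E) x) +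
      f • (⁅X, W⁆ : SmoothVectorField E M) := by
  have : CompleteSpace E := FiniteDimensional.complete ℝ E
  funext x
  rw [mlieBracket_smul_right (hf x) (W.mdiff x), hXf]
  rfl

theorem mdiff_smul_function (W : SmoothVectorField E M) {f : M → ℝ}
    (hf : MDifferentiable 𝓘(ℝ, E) 𝓘(ℝ, ℝ) f) (x : M) :
    MDifferentiableAt 𝓘(ℝ, E) (𝓘(ℝ, E).prod 𝓘(ℝ, E))
      (fun y ↦ ((f • (W : ∀ x, TangentSpace 𝓘(ℝ, E) x)) y : TangentBundle 𝓘(ℝ, E) M)) x :=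
  (hf x).smul_section (W.mdiff x)

theorem commutator_smul (X Y W : SmoothVectorField E M) {f hX hY : M → ℝ}
    (hf : ContMDiff 𝓘(ℝ, E) 𝓘(ℝ, ℝ) ∞ f)
    (hXd : MDifferentiable 𝓘(ℝ, E) 𝓘(ℝ, ℝ) hX) (hYd : MDifferentiable 𝓘(ℝ, E) 𝓘(ℝ, ℝ) hY)
    (hXf : ∀ x, mvfderiv 𝓘(ℝ, E) f x (X x) = hX x)
    (hYf : ∀ x, mvfderiv 𝓘(ℝ, E) f x (Y x) = hY x) (x : M) :
    mvfderiv 𝓘(ℝ, E) f x (⁅X, Y⁆ x) • W x =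
      (mvfderiv 𝓘(ℝ, E) hY x (X x) - mvfderiv 𝓘(ℝ, E) hX x (Y x)) • W x := by
  have : CompleteSpace E := FiniteDimensional.complete ℝ E
  have : IsManifold 𝓘(ℝ, E) (minSmoothness ℝ 3) M := by
    rw [minSmoothness_of_isRCLikeNormedField]; infer_instance
  have hfd : MDifferentiable 𝓘(ℝ, E) 𝓘(ℝ, ℝ) f := hf.mdifferentiable (by simp)
  have h2 : minSmoothness ℝ 2 ≤ ∞ := by
    rw [minSmoothness_of_isRCLikeNormedField]; exact WithTop.coe_le_coe.2 le_top
  have h (W : SmoothVectorField E M) := (W.contMDiff.of_le h2) x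
  have hfW := ((hf.smul_section W.contMDiff).of_le h2) x
  have key := leibniz_identity_mlieBracket_apply (h X) (h Y) hfW
  have e1 := lie_smul_function X W hfd hXf
  have e2 := lie_smul_function Y W hfd hYf
  have e3 := lie_smul_function ⁅X, Y⁆ W hfd (fun _ ↦ rfl)
  have jac : ⁅X, ⁅Y, W⁆⁆ x = ⁅⁅X, Y⁆, W⁆ x + ⁅Y, ⁅X, W⁆⁆ x := by
    rw [leibniz_lie X Y W]; rfl
  change mlieBracket 𝓘(ℝ, E) X (mlieBracket 𝓘(ℝ, E) Y (f • W)) x =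
    mlieBracket 𝓘(ℝ, E) (⁅X, Y⁆ : SmoothVectorField E M) (f • W) x +
      mlieBracket 𝓘(ℝ, E) Y (mlieBracket 𝓘(ℝ, E) X (f • W)) x at key
  rw [e1, e2, e3,
    mlieBracket_add_right (mdiff_smul_function _ hYd x) (mdiff_smul_function _ hfd x),
    mlieBracket_add_right (mdiff_smul_function _ hXd x) (mdiff_smul_function _ hfd x),
    lie_smul_function X W hYd (fun _ ↦ rfl), lie_smul_function Y W hXd (fun _ ↦ rfl),
    lie_smul_function X _ hfd hXf, lie_smul_function Y _ hfd hYf] at key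
  simp only [Pi.add_apply, Pi.smul_apply', jac] at key
  rw [sub_smul]
  linear_combination (norm := module) (-1 : ℝ) • key

/-- The Lie bracket acts on functions as the commutator of derivations. -/
theorem mvfderiv_lie (X Y : SmoothVectorField E M) {f hX hY : M → ℝ}
    (hf : ContMDiff 𝓘(ℝ, E) 𝓘(ℝ, ℝ) ∞ f)
    (hXd : MDifferentiable 𝓘(ℝ, E) 𝓘(ℝ, ℝ) hX) (hYd : MDifferentiable 𝓘(ℝ, E) 𝓘(ℝ, ℝ) hY)
    (hXf : ∀ x, mvfderiv 𝓘(ℝ, E) f x (X x) = hX x)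
    (hYf : ∀ x, mvfderiv 𝓘(ℝ, E) f x (Y x) = hY x) (x : M) :
    mvfderiv 𝓘(ℝ, E) f x (⁅X, Y⁆ x) =
      mvfderiv 𝓘(ℝ, E) hY x (X x) - mvfderiv 𝓘(ℝ, E) hX x (Y x) := by
  by_contra hne
  have h0 (W : SmoothVectorField E M) : W x = 0 := by
    have h := commutator_smul X Y W hf hXd hYd hXf hYf x
    rw [← sub_eq_zero, ← sub_smul] at h
    exact (smul_eq_zero.1 h).resolve_left (sub_ne_zero.2 hne)
  exact hne (by rw [h0, h0, h0]; simp)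

end Commutator

section Riemannian

variable {E : Type*} [NormedAddCommGroup E] [NormedSpace ℝ E] [FiniteDimensional ℝ E]
  {M : Type*} [TopologicalSpace M] [ChartedSpace E M] [IsManifold 𝓘(ℝ, E) ∞ M]
  [RiemannianBundle (fun x : M ↦ TangentSpace 𝓘(ℝ, E) x)]

/-- `X` is a Killing field: the Lie derivative of the metric along `X` vanishes, that is,
`X (g(Y, Z)) = g([X, Y], Z) + g(Y, [X, Z])` for all smooth vector fields `Y`, `Z`. -/
def IsKilling (X : SmoothVectorField E M) : Prop :=
  ∀ (Y Z : SmoothVectorField E M) (x : M),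
    mvfderiv 𝓘(ℝ, E) (fun y ↦ inner ℝ (Y y) (Z y)) x (X x) =
      inner ℝ (⁅X, Y⁆ x) (Z x) + inner ℝ (Y x) (⁅X, Z⁆ x)

section Algebra

variable [IsContMDiffRiemannianBundle 𝓘(ℝ, E) ∞ E (fun x : M ↦ TangentSpace 𝓘(ℝ, E) x)]

set_option linter.unusedSectionVars false in
theorem contMDiff_inner (Y Z : SmoothVectorField E M) :
    ContMDiff 𝓘(ℝ, E) 𝓘(ℝ, ℝ) ∞ (fun y ↦ inner ℝ (Y y) (Z y)) :=
  ContMDiff.inner_bundle (E := fun x : M ↦ TangentSpace 𝓘(ℝ, E) x) Y.contMDiff Z.contMDiff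

theorem mdifferentiable_inner (Y Z : SmoothVectorField E M) :
    MDifferentiable 𝓘(ℝ, E) 𝓘(ℝ, ℝ) (fun y ↦ inner ℝ (Y y) (Z y)) :=
  (contMDiff_inner Y Z).mdifferentiable (by simp)

theorem IsKilling.lie {X₁ X₂ : SmoothVectorField E M} (h₁ : IsKilling X₁) (h₂ : IsKilling X₂) :
    IsKilling ⁅X₁, X₂⁆ := by
  intro Y Z x
  have hd (X : SmoothVectorField E M) : MDifferentiable 𝓘(ℝ, E) 𝓘(ℝ, ℝ)
      (fun y ↦ inner ℝ (⁅X, Y⁆ y) (Z y) + inner ℝ (Y y) (⁅X, Z⁆ y)) :=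
    fun y ↦ (mdifferentiable_inner _ _ y).add (mdifferentiable_inner _ _ y)
  rw [mvfderiv_lie X₁ X₂ (contMDiff_inner Y Z) (hd X₁) (hd X₂) (h₁ Y Z) (h₂ Y Z) x,
    mvfderiv_fun_add (mdifferentiable_inner _ _ x) (mdifferentiable_inner _ _ x),
    mvfderiv_fun_add (mdifferentiable_inner _ _ x) (mdifferentiable_inner _ _ x)]
  have jac (W : SmoothVectorField E M) : ⁅⁅X₁, X₂⁆, W⁆ x = ⁅X₁, ⁅X₂, W⁆⁆ x - ⁅X₂, ⁅X₁, W⁆⁆ x := by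
    rw [lie_lie]; rfl
  simp only [add_apply, h₁ _ _ x, h₂ _ _ x, jac, inner_sub_left,
    inner_sub_right]
  ring

variable (E M) in
/-- The Lie algebra of Killing fields. -/
def killingAlgebra : LieSubalgebra ℝ (SmoothVectorField E M) where
  carrier := {X | IsKilling X}
  zero_mem' := by
    intro Y Z x
    simp
  add_mem' {X₁ X₂} h₁ h₂ := by
    intro Y Z x
    have e (W : SmoothVectorField E M) : ⁅X₁ + X₂, W⁆ x = ⁅X₁, W⁆ x + ⁅X₂, W⁆ x := by
      rw [add_lie]; rfl
    have e' : (X₁ + X₂) x = X₁ x + X₂ x := rfl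
    rw [e, e, e', map_add, h₁ Y Z x, h₂ Y Z x, inner_add_left, inner_add_right]
    ring
  smul_mem' c X h := by
    intro Y Z x
    have e (W : SmoothVectorField E M) : ⁅c • X, W⁆ x = c • ⁅X, W⁆ x := by
      rw [smul_lie]; rfl
    have e' : (c • X) x = c • X x := rfl
    rw [e, e, e', map_smul, h Y Z x, real_inner_smul_left, real_inner_smul_right, smul_eq_mul]
    ring
  lie_mem' h₁ h₂ := h₁.lie h₂

end Algebra

/-- The metric read in the chart at `x₀`: `g_y(u, v)` for `y` in the target of the chart. -/
def chartMetric (x₀ : M) (y u v : E) : ℝ :=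
  inner ℝ
    (mfderiv 𝓘(ℝ, E) 𝓘(ℝ, E) (extChartAt 𝓘(ℝ, E) x₀).symm y u :
      TangentSpace 𝓘(ℝ, E) ((extChartAt 𝓘(ℝ, E) x₀).symm y))
    (mfderiv 𝓘(ℝ, E) 𝓘(ℝ, E) (extChartAt 𝓘(ℝ, E) x₀).symm y v)

/-- The Christoffel symbols of the first kind in the chart at `x₀`:
`Γ_y(u, v; w) = (∂_u g(v, w) + ∂_v g(u, w) - ∂_w g(u, v)) / 2`. -/
def chartChristoffel (x₀ : M) (y u v w : E) : ℝ :=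
  (fderiv ℝ (fun z ↦ chartMetric x₀ z v w) y u + fderiv ℝ (fun z ↦ chartMetric x₀ z u w) y v
    - fderiv ℝ (fun z ↦ chartMetric x₀ z u v) y w) / 2

variable (E) in
/-- The curve `γ` read in the chart at `x₀` satisfies the geodesic equation at time `t`:
`g(c'', w) + Γ(c', c'; w) = 0` for all `w`. The left-hand side is `g(∇_{γ'} γ', w)` in the chart,
so that the condition does not depend on the chart. -/
def SatisfiesGeodesicEquationInChart (x₀ : M) (γ : ℝ → M) (t : ℝ) : Prop :=
  let c : ℝ → E := fun s ↦ extChartAt 𝓘(ℝ, E) x₀ (γ s)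
  ∀ w : E, chartMetric x₀ (c t) (deriv (deriv c) t) w
    + chartChristoffel x₀ (c t) (deriv c t) (deriv c t) w = 0

variable (E) in
/-- `γ` is an (affinely parametrized) geodesic on the open set `J` of times: it is twice
continuously differentiable there and each of its points has a chart in which the geodesic equation
holds. -/
def IsGeodesicOn (γ : ℝ → M) (J : Set ℝ) : Prop :=
  ContMDiffOn 𝓘(ℝ, ℝ) 𝓘(ℝ, E) 2 γ J ∧
    ∀ t ∈ J, ∃ x₀ : M, γ t ∈ (chartAt E x₀).source ∧ SatisfiesGeodesicEquationInChart E x₀ γ t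

/-- A Riemannian isometry: a diffeomorphism whose differentials preserve the metric. -/
def IsRiemannianIsometry (f : M ≃ₘ⟮𝓘(ℝ, E), 𝓘(ℝ, E)⟯ M) : Prop :=
  ∀ (x : M) (u v : TangentSpace 𝓘(ℝ, E) x),
    inner ℝ (mfderiv 𝓘(ℝ, E) 𝓘(ℝ, E) f x u) (mfderiv 𝓘(ℝ, E) 𝓘(ℝ, E) f x v) = inner ℝ u v

/-- A one-parameter subgroup of the full isometry group: a smooth action of `ℝ` by isometries. -/
structure IsOneParameterIsometryGroup (φ : ℝ → (M ≃ₘ⟮𝓘(ℝ, E), 𝓘(ℝ, E)⟯ M)) : Prop where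
  isometry : ∀ t, IsRiemannianIsometry (φ t)
  map_zero : ∀ x, φ 0 x = x
  map_add : ∀ s t x, φ (s + t) x = φ s (φ t x)
  contMDiff : ContMDiff (𝓘(ℝ, ℝ).prod 𝓘(ℝ, E)) 𝓘(ℝ, E) ∞ (fun p : ℝ × M ↦ φ p.1 p.2)

variable (E M) in
/-- `M` is a geodesic orbit manifold: every geodesic, defined on any open interval `J`, is (the
part over `J` of) an orbit of a one-parameter subgroup of the full isometry group. -/
def IsGeodesicOrbitManifold : Prop :=
  ∀ (γ : ℝ → M) (J : Set ℝ), IsOpen J → J.OrdConnected → IsGeodesicOn E γ J →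
    ∃ φ : ℝ → (M ≃ₘ⟮𝓘(ℝ, E), 𝓘(ℝ, E)⟯ M), IsOneParameterIsometryGroup φ ∧
      ∃ p : M, ∀ t ∈ J, γ t = φ t p

end Riemannian

end GOManifold

end

/-! The squared length of `X` is shown to be critical at every point `x`; connectedness then makes
it constant.

By the geodesic orbit property, the geodesic with initial velocity `X x` is an orbit of a
one-parameter group of isometries. Its generator `Z` is Killing with `Z x = X x`. Since `g(∇_Z Z, ·)
= -d|Z|²/2` for a Killing field and the orbit through `x` is a geodesic, `|Z|²` is critical at `x`.
Hence `⟨[Y, Z], X⟩ = 0` at `x` for every Killing field `Y`.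

Put `W = Z - X`. As `W x = 0`, the Killing equation says that bracketing with `W` is skew-symmetric
at `x`. Expanding `Z = X + W` therefore gives, at `x`, `⟨[Y, X], X⟩ + ⟨Y, [W, X]⟩ = 0` for every
Killing field `Y`. Choose `Y = [W, X]`. It lies in the ideal, so it commutes with `X`, and the
identity reduces to `|[W, X]|² = 0` at `x`. Now `⟨[Y, X], X⟩ = 0` at `x` for all Killing `Y`, that
is, `Y(|X|²) = 0` there. By the geodesic orbit property again, the values of Killing fields exhaust
the tangent space at `x`.

The analytic input is `IsGeodesicOrbitManifold.exists_isKilling`, which rests on local existence of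
geodesics (`exists_geodesic_in_coordinates`) and on the fact that generators are Killing
(`satisfiesKillingEquationAt_flowVelocity`). The algebra is in
`IsGeodesicOrbitManifold.mvfderiv_inner_self_eq_zero`. -/

open scoped Topology

noncomputable section

namespace GOManifold

/-! ### Flows, the Killing equation and geodesics on an open subset of a vector space. -/

section Coordinates

set_option maxSynthPendingDepth 3

variable {E : Type*} [NormedAddCommGroup E] [NormedSpace ℝ E]

/-- The velocity field of a flow `Φ` on a vector space. -/
def flowVelocity (Φ : ℝ × E → E) (z : E) : E := fderiv ℝ Φ (0, z) (1, 0)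

theorem fderiv_flow_space {Φ : ℝ × E → E} {y : E} (hΦ : DifferentiableAt ℝ Φ (0, y))
    (h0 : ∀ᶠ z in 𝓝 y, Φ (0, z) = z) (u : E) : fderiv ℝ Φ (0, y) (0, u) = u := by
  have h2 : HasFDerivAt (fun z : E ↦ ((0 : ℝ), z)) (ContinuousLinearMap.inr ℝ ℝ E) y :=
    hasFDerivAt_prodMk_right 0 y
  have h3 : HasFDerivAt (fun z : E ↦ Φ (0, z))
      ((fderiv ℝ Φ (0, y)).comp (ContinuousLinearMap.inr ℝ ℝ E)) y :=
    HasFDerivAt.comp y (f := fun z : E ↦ ((0 : ℝ), z)) hΦ.hasFDerivAt h2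
  have h4 : HasFDerivAt (fun z : E ↦ Φ (0, z)) (ContinuousLinearMap.id ℝ E) y :=
    (hasFDerivAt_id y).congr_of_eventuallyEq h0
  simpa using congrArg (fun A : E →L[ℝ] E ↦ A u) (h3.unique h4)

/-- Mixed partial derivatives in time and space commute, by symmetry of the second derivative of
`Φ`. -/
theorem hasDerivAt_fderiv_flow {Φ : ℝ × E → E} {y : E} (hΦ : ContDiffAt ℝ 2 Φ (0, y)) (u : E) :
    HasDerivAt (fun t : ℝ ↦ fderiv ℝ Φ (t, y) (0, u)) (fderiv ℝ (flowVelocity Φ) y u) 0 := by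
  have h1 : DifferentiableAt ℝ (fderiv ℝ Φ) (0, y) :=
    (hΦ.fderiv_right (m := 1) (by norm_num)).differentiableAt (by simp)
  have h2 : HasFDerivAt (fun z : E ↦ ((0 : ℝ), z)) (ContinuousLinearMap.inr ℝ ℝ E) y :=
    hasFDerivAt_prodMk_right 0 y
  have h3 : HasDerivAt (fun t : ℝ ↦ (t, y)) ((1 : ℝ), (0 : E)) 0 :=
    (hasDerivAt_id (0 : ℝ)).prodMk (hasDerivAt_const 0 y)
  have h4 : HasDerivAt (fun t : ℝ ↦ fderiv ℝ Φ (t, y)) (fderiv ℝ (fderiv ℝ Φ) (0, y) (1, 0)) 0 :=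
    HasFDerivAt.comp_hasDerivAt (0 : ℝ) (f := fun t : ℝ ↦ (t, y)) h1.hasFDerivAt h3
  have h5 : HasFDerivAt (fun z : E ↦ fderiv ℝ Φ (0, z))
      ((fderiv ℝ (fderiv ℝ Φ) (0, y)).comp (ContinuousLinearMap.inr ℝ ℝ E)) y :=
    HasFDerivAt.comp y (f := fun z : E ↦ ((0 : ℝ), z)) h1.hasFDerivAt h2
  have h6 := h5.clm_apply (hasFDerivAt_const ((1 : ℝ), (0 : E)) y)
  have h7 : fderiv ℝ (flowVelocity Φ) y u = fderiv ℝ (fderiv ℝ Φ) (0, y) (0, u) (1, 0) := by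
    rw [show flowVelocity Φ = fun z ↦ fderiv ℝ Φ (0, z) (1, 0) from rfl, h6.fderiv]
    simp
  have hs : IsSymmSndFDerivAt ℝ Φ (0, y) := hΦ.isSymmSndFDerivAt (by simp)
  rw [h7, hs.eq]
  simpa using h4.clm_apply (hasDerivAt_const (0 : ℝ) ((0 : ℝ), u))

/-- The Killing equation at `y`, in coordinates. -/
def SatisfiesKillingEquationAt (G : E → E →L[ℝ] E →L[ℝ] ℝ) (Z : E → E) (y : E) : Prop :=
  ∀ u v, fderiv ℝ G y (Z y) u v + G y (fderiv ℝ Z y u) v + G y u (fderiv ℝ Z y v) = 0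

/-- The Killing equation is the derivative at `t = 0` of the isometry identity `hiso`. -/
theorem satisfiesKillingEquationAt_flowVelocity {G : E → E →L[ℝ] E →L[ℝ] ℝ} {Φ : ℝ × E → E}
    {y : E} (hG : DifferentiableAt ℝ G y) (hΦ : ContDiffAt ℝ 2 Φ (0, y))
    (h0 : ∀ᶠ z in 𝓝 y, Φ (0, z) = z)
    (hiso : ∀ᶠ t in 𝓝 (0 : ℝ), ∀ u v,
      G (Φ (t, y)) (fderiv ℝ Φ (t, y) (0, u)) (fderiv ℝ Φ (t, y) (0, v)) = G y u v) :
    SatisfiesKillingEquationAt G (flowVelocity Φ) y := by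
  intro u v
  have hd : DifferentiableAt ℝ Φ (0, y) := hΦ.differentiableAt (by simp)
  have h3 : HasDerivAt (fun t : ℝ ↦ (t, y)) ((1 : ℝ), (0 : E)) 0 :=
    (hasDerivAt_id (0 : ℝ)).prodMk (hasDerivAt_const 0 y)
  have h4 : HasDerivAt (fun t : ℝ ↦ Φ (t, y)) (flowVelocity Φ y) 0 :=
    HasFDerivAt.comp_hasDerivAt (0 : ℝ) (f := fun t : ℝ ↦ (t, y)) hd.hasFDerivAt h3
  have hy : Φ (0, y) = y := h0.self_of_nhds
  have h5 : HasDerivAt (fun t : ℝ ↦ G (Φ (t, y))) (fderiv ℝ G y (flowVelocity Φ y)) 0 := by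
    have hG' : HasFDerivAt G (fderiv ℝ G y) (Φ (0, y)) := by rw [hy]; exact hG.hasFDerivAt
    exact HasFDerivAt.comp_hasDerivAt (0 : ℝ) (f := fun t : ℝ ↦ Φ (t, y)) hG' h4
  have h6 := (h5.clm_apply (hasDerivAt_fderiv_flow hΦ u)).clm_apply (hasDerivAt_fderiv_flow hΦ v)
  have h7 := h6.unique ((hasDerivAt_const (0 : ℝ) (G y u v)).congr_of_eventuallyEq
    (hiso.mono fun t ht ↦ ht u v))
  rw [fderiv_flow_space hd h0, fderiv_flow_space hd h0, hy] at h7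
  simpa using h7

theorem fderiv_bilin_apply {G : E → E →L[ℝ] E →L[ℝ] ℝ} {Y W : E → E} {y : E}
    (hG : DifferentiableAt ℝ G y) (hY : DifferentiableAt ℝ Y y) (hW : DifferentiableAt ℝ W y)
    (w : E) :
    fderiv ℝ (fun z ↦ G z (Y z) (W z)) y w =
      fderiv ℝ G y w (Y y) (W y) + G y (fderiv ℝ Y y w) (W y) + G y (Y y) (fderiv ℝ W y w) := by
  have h := (hG.hasFDerivAt.clm_apply hY.hasFDerivAt).clm_apply hW.hasFDerivAt
  rw [h.fderiv]
  simp
  ring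

theorem SatisfiesKillingEquationAt.fderiv_apply {G : E → E →L[ℝ] E →L[ℝ] ℝ} {Z : E → E} {y : E}
    (h : SatisfiesKillingEquationAt G Z y) {Y W : E → E}
    (hG : DifferentiableAt ℝ G y) (hY : DifferentiableAt ℝ Y y) (hW : DifferentiableAt ℝ W y) :
    fderiv ℝ (fun z ↦ G z (Y z) (W z)) y (Z y) =
      G y (lieBracket ℝ Z Y y) (W y) + G y (Y y) (lieBracket ℝ Z W y) := by
  rw [fderiv_bilin_apply hG hY hW, lieBracket, lieBracket]
  have := h (Y y) (W y)
  simp only [map_sub, sub_apply]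
  linarith

/-- The geodesic equation for the velocity `v` and the acceleration `a` at `y`, in coordinates. -/
def SatisfiesGeodesicEquationAt (G : E → E →L[ℝ] E →L[ℝ] ℝ) (y v a : E) : Prop :=
  ∀ w, G y a w + (fderiv ℝ G y v v w + fderiv ℝ G y v v w - fderiv ℝ G y w v v) / 2 = 0

/-- An integral curve of `Z` has acceleration `DZ(Z)`. Subtracting the geodesic equation from the
Killing equation at the pair `(Z, w)` leaves `G(Z, DZ w) + D_w G(Z, Z) / 2 = 0`, which is half of
the claim. -/
theorem SatisfiesKillingEquationAt.fderiv_apply_self_eq_zero {G : E → E →L[ℝ] E →L[ℝ] ℝ}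
    {Z : E → E} {y : E} (h : SatisfiesKillingEquationAt G Z y) (hG : DifferentiableAt ℝ G y)
    (hZ : DifferentiableAt ℝ Z y) (hsymm : ∀ u v, G y u v = G y v u)
    (hgeo : SatisfiesGeodesicEquationAt G y (Z y) (fderiv ℝ Z y (Z y))) (w : E) :
    fderiv ℝ (fun z ↦ G z (Z z) (Z z)) y w = 0 := by
  rw [fderiv_bilin_apply hG hZ hZ]
  have h1 := h (Z y) w
  have h2 := hgeo w
  have h3 := hsymm (fderiv ℝ Z y w) (Z y)
  linarith

/-- Local existence of geodesics in coordinates. -/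
theorem exists_geodesic_in_coordinates [FiniteDimensional ℝ E] {G : E → E →L[ℝ] E →L[ℝ] ℝ}
    {T : Set E} (hT : IsOpen T) (hG : ContDiffOn ℝ ∞ G T)
    (hpos : ∀ z ∈ T, ∀ u, u ≠ 0 → 0 < G z u u) {y : E} (hy : y ∈ T) (v : E) :
    ∃ ε > 0, ∃ c : ℝ → E, c 0 = y ∧ deriv c 0 = v ∧ Set.MapsTo c (Set.Ioo (-ε) ε) T ∧
      ContDiffOn ℝ 2 c (Set.Ioo (-ε) ε) ∧
      ∀ t ∈ Set.Ioo (-ε) ε, SatisfiesGeodesicEquationAt G (c t) (deriv c t) (deriv (deriv c) t) := by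
  have : CompleteSpace E := FiniteDimensional.complete ℝ E
  -- Definiteness makes `G z` injective into the dual, which has the same dimension; so the geodesic
  -- equation can be solved for the acceleration.
  have hinv : ∀ z ∈ T, (G z).IsInvertible := by
    intro z hz
    have hinj : Function.Injective (G z : E →ₗ[ℝ] (E →L[ℝ] ℝ)) := by
      rw [← LinearMap.ker_eq_bot, LinearMap.ker_eq_bot']
      intro u hu
      by_contra hne
      have := hpos z hz u hne
      rw [show G z u = 0 from hu] at this
      simp at this
    have hdim : Module.finrank ℝ E = Module.finrank ℝ (E →L[ℝ] ℝ) := by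
      rw [← (LinearMap.toContinuousLinearMap (𝕜 := ℝ) (E := E) (F' := ℝ)).finrank_eq]
      exact (Subspace.dual_finrank_eq (K := ℝ) (V := E)).symm
    exact ⟨(LinearEquiv.ofInjectiveOfFinrankEq (G z : E →ₗ[ℝ] (E →L[ℝ] ℝ)) hinj
      hdim).toContinuousLinearEquiv, by ext; rfl⟩
  have hDG : ContDiffOn ℝ 1 (fderiv ℝ G) T :=
    hG.fderiv_of_isOpen hT (by rw [one_add_one_eq_two]; exact WithTop.coe_le_coe.2 le_top)
  -- At `p = (z, v)` this is minus the Christoffel form, `w ↦ D_w G(v, v) / 2 - D_v G(v, w)`. The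
  -- geodesic equation becomes the first-order system `(c, c')' = F (c, c')`, to which
  -- Picard–Lindelöf applies.
  let Γ : E × E → E →L[ℝ] ℝ := fun p ↦
    (2 : ℝ)⁻¹ • ((fderiv ℝ G p.1).flip p.2).flip p.2 - fderiv ℝ G p.1 p.2 p.2
  let F : E × E → E × E := fun p ↦ (p.2, (G p.1).inverse (Γ p))
  let S : Set (E × E) := Prod.fst ⁻¹' T
  have hS : IsOpen S := hT.preimage continuous_fst
  have hF : ContDiffOn ℝ 1 F S := by
    have hDGp : ContDiffOn ℝ 1 (fun q : E × E ↦ fderiv ℝ G q.1) S :=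
      hDG.comp contDiffOn_fst fun _ h ↦ h
    have hGp : ContDiffOn ℝ 1 (fun q : E × E ↦ (G q.1).inverse) S := fun p hp ↦
      (ContDiffAt.comp p ((hinv _ hp).contDiffAt_map_inverse)
        (((hG.contDiffAt (hT.mem_nhds hp)).of_le (by simp)).comp p
          contDiffAt_fst)).contDiffWithinAt
    have hΓ : ContDiffOn ℝ 1 Γ S := by
      rw [contDiffOn_clm_apply]
      intro w
      have h1 : ContDiffOn ℝ 1 (fun q : E × E ↦ fderiv ℝ G q.1 w q.2 q.2) S :=
        ((hDGp.clm_apply contDiffOn_const).clm_apply contDiffOn_snd).clm_apply contDiffOn_snd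
      have h2 : ContDiffOn ℝ 1 (fun q : E × E ↦ fderiv ℝ G q.1 q.2 q.2 w) S :=
        ((hDGp.clm_apply contDiffOn_snd).clm_apply contDiffOn_snd).clm_apply contDiffOn_const
      exact (h1.const_smul (2 : ℝ)⁻¹).sub h2
    exact contDiffOn_snd.prodMk (hGp.clm_apply hΓ)
  have hyS : (y, v) ∈ S := hy
  obtain ⟨α, hα0, ε, hε, hα⟩ := (hF.contDiffAt
    (hS.mem_nhds hyS)).exists_forall_mem_closedBall_exists_eq_forall_mem_Ioo_hasDerivAt₀ 0
  simp only [zero_sub, zero_add] at hα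
  -- The time interval is shortened so that the curve stays in `T`, where `G` is known to be smooth
  -- and invertible.
  have hα0S : ∀ᶠ t in 𝓝 (0 : ℝ), α t ∈ S :=
    (hα 0 ⟨by linarith, hε⟩).continuousAt (hS.mem_nhds (by rw [hα0]; exact hyS))
  obtain ⟨δ, hδ, hδS⟩ := Metric.eventually_nhds_iff.1 hα0S
  have hα' : ∀ t ∈ Set.Ioo (-min ε δ) (min ε δ), HasDerivAt α (F (α t)) t ∧ α t ∈ S := by
    intro t ht
    rw [Set.mem_Ioo, ← abs_lt, lt_min_iff] at ht
    exact ⟨hα t (abs_lt.1 ht.1), hδS (by simpa using ht.2)⟩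
  have hc : ∀ t ∈ Set.Ioo (-min ε δ) (min ε δ), HasDerivAt (fun t ↦ (α t).1) (α t).2 t :=
    fun t ht ↦ (hα' t ht).1.fst
  have hc' : ∀ t ∈ Set.Ioo (-min ε δ) (min ε δ),
      HasDerivAt (fun t ↦ (α t).2) ((G (α t).1).inverse (Γ (α t))) t :=
    fun t ht ↦ (hα' t ht).1.snd
  have hαd : DifferentiableOn ℝ α (Set.Ioo (-min ε δ) (min ε δ)) :=
    fun t ht ↦ (hα' t ht).1.differentiableAt.differentiableWithinAt
  -- Regularity bootstrap: `α' = F ∘ α` is continuous, so `α` is `C¹`; as `c'` is a component of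
  -- `α`, the curve `c` is `C²`.
  have hα1 : ContDiffOn ℝ 1 α (Set.Ioo (-min ε δ) (min ε δ)) := by
    rw [show (1 : ℕ∞ω) = 0 + 1 from rfl, contDiffOn_succ_iff_deriv_of_isOpen isOpen_Ioo]
    refine ⟨hαd, by simp, ?_⟩
    rw [contDiffOn_zero]
    exact (hF.continuousOn.comp hαd.continuousOn fun t ht ↦ (hα' t ht).2).congr
      fun t ht ↦ (hα' t ht).1.deriv
  refine ⟨min ε δ, lt_min hε hδ, fun t ↦ (α t).1, by simp [hα0], ?_, fun t ht ↦ (hα' t ht).2, ?_, ?_⟩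
  · rw [(hc 0 ⟨by simp [hε, hδ], by simp [hε, hδ]⟩).deriv, hα0]
  · rw [← one_add_one_eq_two, contDiffOn_succ_iff_deriv_of_isOpen isOpen_Ioo]
    exact ⟨fun t ht ↦ (hc t ht).differentiableAt.differentiableWithinAt, by simp,
      (contDiff_snd.comp_contDiffOn hα1).congr fun t ht ↦ (hc t ht).deriv⟩
  · intro t ht w
    have h2 : deriv (deriv fun t ↦ (α t).1) t = (G (α t).1).inverse (Γ (α t)) := by
      rw [← (hc' t ht).deriv]
      apply Filter.EventuallyEq.deriv_eq
      filter_upwards [isOpen_Ioo.mem_nhds ht] with s hs using (hc s hs).deriv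
    rw [h2, (hc t ht).deriv, (hinv _ (hα' t ht).2).self_apply_inverse]
    simp [Γ]
    ring

end Coordinates

/-! ### Vector fields, brackets and the metric read in a chart. -/

section Chart

set_option maxSynthPendingDepth 3
set_option linter.unusedSectionVars false

variable {E : Type*} [NormedAddCommGroup E] [NormedSpace ℝ E] [FiniteDimensional ℝ E]
  {M : Type*} [TopologicalSpace M] [ChartedSpace E M] [IsManifold 𝓘(ℝ, E) ∞ M]

theorem contMDiffAt_extChartAt_symm (x : M) {z : E} (hz : z ∈ (extChartAt 𝓘(ℝ, E) x).target) :
    ContMDiffAt 𝓘(ℝ, E) 𝓘(ℝ, E) ∞ (extChartAt 𝓘(ℝ, E) x).symm z :=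
  (contMDiffOn_extChartAt_symm x).contMDiffAt ((isOpen_extChartAt_target x).mem_nhds hz)

theorem mfderiv_extChartAt_symm_self (x : M) :
    mfderiv 𝓘(ℝ, E) 𝓘(ℝ, E) (extChartAt 𝓘(ℝ, E) x).symm (extChartAt 𝓘(ℝ, E) x x) =
      ContinuousLinearMap.id ℝ E := by
  have : IsManifold 𝓘(ℝ, E) 1 M := .of_le (n := ∞) (by simp)
  have h := mfderivWithin_range_extChartAt_symm (I := 𝓘(ℝ, E)) (x := x)
  rw [ModelWithCorners.range_eq_univ, mfderivWithin_univ] at h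
  exact h

theorem isInvertible_mfderiv_extChartAt_symm (x : M) {z : E}
    (hz : z ∈ (extChartAt 𝓘(ℝ, E) x).target) :
    (mfderiv 𝓘(ℝ, E) 𝓘(ℝ, E) (extChartAt 𝓘(ℝ, E) x).symm z).IsInvertible := by
  have : IsManifold 𝓘(ℝ, E) 1 M := .of_le (n := ∞) (by simp)
  have h := isInvertible_mfderivWithin_extChartAt_symm (I := 𝓘(ℝ, E)) (x := x) hz
  rwa [ModelWithCorners.range_eq_univ, mfderivWithin_univ] at h

theorem mfderiv_extChartAt_symm_injective (x : M) {z : E}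
    (hz : z ∈ (extChartAt 𝓘(ℝ, E) x).target) :
    Function.Injective (mfderiv 𝓘(ℝ, E) 𝓘(ℝ, E) (extChartAt 𝓘(ℝ, E) x).symm z) := by
  obtain ⟨e, he⟩ := isInvertible_mfderiv_extChartAt_symm x hz
  rw [← he]
  exact e.injective

/-- A vector field read in the chart at `x`. -/
def chartField (x : M) (X : ∀ p : M, TangentSpace 𝓘(ℝ, E) p) (z : E) : E :=
  (mpullback 𝓘(ℝ, E) 𝓘(ℝ, E) (extChartAt 𝓘(ℝ, E) x).symm X z : TangentSpace 𝓘(ℝ, E) z)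

theorem mfderiv_symm_chartField (x : M) (X : ∀ p : M, TangentSpace 𝓘(ℝ, E) p) {z : E}
    (hz : z ∈ (extChartAt 𝓘(ℝ, E) x).target) :
    mfderiv 𝓘(ℝ, E) 𝓘(ℝ, E) (extChartAt 𝓘(ℝ, E) x).symm z (chartField (E := E) x X z) =
      X ((extChartAt 𝓘(ℝ, E) x).symm z) := by
  obtain ⟨e, he⟩ := isInvertible_mfderiv_extChartAt_symm x hz
  rw [chartField, mpullback_apply, ← he, ContinuousLinearMap.inverse_equiv]
  exact e.apply_symm_apply _

theorem chartField_eq_of_mfderiv_symm_eq (x : M) (X : ∀ p : M, TangentSpace 𝓘(ℝ, E) p) {z : E}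
    (hz : z ∈ (extChartAt 𝓘(ℝ, E) x).target) {u : E}
    (h : mfderiv 𝓘(ℝ, E) 𝓘(ℝ, E) (extChartAt 𝓘(ℝ, E) x).symm z u =
      X ((extChartAt 𝓘(ℝ, E) x).symm z)) : chartField x X z = u :=
  mfderiv_extChartAt_symm_injective x hz ((mfderiv_symm_chartField x X hz).trans h.symm)

theorem chartField_self (x : M) (X : ∀ p : M, TangentSpace 𝓘(ℝ, E) p) :
    chartField x X (extChartAt 𝓘(ℝ, E) x x) = (X x : E) := by
  apply chartField_eq_of_mfderiv_symm_eq x X (mem_extChartAt_target x)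
  rw [mfderiv_extChartAt_symm_self]
  -- The point `symm (chart x)` equals `x` only propositionally, so the base point is generalized
  -- before substituting.
  have h : ∀ p, p = x → (X x : E) = (X p : E) := by rintro p rfl; rfl
  exact h _ (extChartAt_to_inv x)

theorem mfderiv_symm_mfderiv_extChartAt (x : M) {p : M} (hp : p ∈ (extChartAt 𝓘(ℝ, E) x).source)
    (a : TangentSpace 𝓘(ℝ, E) p) :
    mfderiv 𝓘(ℝ, E) 𝓘(ℝ, E) (extChartAt 𝓘(ℝ, E) x).symm (extChartAt 𝓘(ℝ, E) x p)
      (mfderiv 𝓘(ℝ, E) 𝓘(ℝ, E) (extChartAt 𝓘(ℝ, E) x) p a) = (a : E) := by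
  have : IsManifold 𝓘(ℝ, E) 1 M := .of_le (n := ∞) (by simp)
  have h := mfderivWithin_extChartAt_symm_comp_mfderiv_extChartAt' (I := 𝓘(ℝ, E)) (x := x) hp
  rw [ModelWithCorners.range_eq_univ, mfderivWithin_univ] at h
  exact congrArg (fun A : E →L[ℝ] E ↦ A a) h

theorem chartField_eq_mfderiv (x : M) (X : ∀ p : M, TangentSpace 𝓘(ℝ, E) p) {p : M}
    (hp : p ∈ (extChartAt 𝓘(ℝ, E) x).source) :
    chartField x X (extChartAt 𝓘(ℝ, E) x p) =
      mfderiv 𝓘(ℝ, E) 𝓘(ℝ, E) (extChartAt 𝓘(ℝ, E) x) p (X p) := by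
  apply chartField_eq_of_mfderiv_symm_eq x X ((extChartAt 𝓘(ℝ, E) x).map_source hp)
  refine (mfderiv_symm_mfderiv_extChartAt x hp (X p)).trans ?_
  have h : ∀ q, q = p → (X p : E) = (X q : E) := by rintro q rfl; rfl
  exact h _ ((extChartAt 𝓘(ℝ, E) x).left_inv hp)

theorem differentiableAt_chartField (x : M) (X : SmoothVectorField E M) :
    DifferentiableAt ℝ (chartField x X) (extChartAt 𝓘(ℝ, E) x x) := by
  have : CompleteSpace E := FiniteDimensional.complete ℝ E
  have : IsManifold 𝓘(ℝ, E) (((⊤ : ℕ∞) : WithTop ℕ∞) + 1) M := by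
    simpa using (inferInstance : IsManifold 𝓘(ℝ, E) ∞ M)
  have h := contMDiffWithinAt_mpullbackWithin_extChartAt_symm (I := 𝓘(ℝ, E)) (s := Set.univ)
    (n := ∞) (m := ∞) (x := x) (V := X) (X.contMDiff x).contMDiffWithinAt
    uniqueMDiffOn_univ (Set.mem_univ _) (by simp)
  rw [Set.preimage_univ, Set.inter_univ, ModelWithCorners.range_eq_univ, mpullbackWithin_univ] at h
  have h2 := (contMDiffAt_vectorSpace_iff_contDiffAt (V := chartField x X)).1
    (h.contMDiffAt (extChartAt_target_mem_nhds x))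
  exact h2.differentiableAt (by simp)

/-- The chart at `x` has identity differential at `x`, so no correction factor appears. -/
theorem mlieBracket_eq_lieBracket_chartField (x : M) (X Y : ∀ p : M, TangentSpace 𝓘(ℝ, E) p) :
    mlieBracket 𝓘(ℝ, E) X Y x =
      lieBracket ℝ (chartField x X) (chartField x Y) (extChartAt 𝓘(ℝ, E) x x) := by
  have : IsManifold 𝓘(ℝ, E) 1 M := .of_le (n := ∞) (by simp)
  rw [← mlieBracketWithin_univ, mlieBracketWithin_apply, mfderiv_extChartAt_self]
  simp only [Set.preimage_univ, Set.univ_inter, ModelWithCorners.range_eq_univ,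
    mpullbackWithin_univ]
  change (ContinuousLinearMap.inverse (ContinuousLinearMap.id ℝ E)) _ = _
  rw [ContinuousLinearMap.inverse_id, ← lieBracketWithin_univ]
  rfl

theorem mvfderiv_eq_fderiv_chart (x : M) {h : M → ℝ} (hh : MDifferentiableAt 𝓘(ℝ, E) 𝓘(ℝ, ℝ) h x)
    (u : TangentSpace 𝓘(ℝ, E) x) :
    mvfderiv 𝓘(ℝ, E) h x u =
      fderiv ℝ (fun z ↦ h ((extChartAt 𝓘(ℝ, E) x).symm z)) (extChartAt 𝓘(ℝ, E) x x) u := by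
  have h1 := hh.mvfderiv
  rw [h1]
  simp [writtenInExtChartAt]
  rfl

/-- The function is constant on the preimage of a small ball in each chart, hence locally constant;
connectedness does the rest. -/
theorem exists_eq_const_of_mvfderiv_eq_zero [ConnectedSpace M] {h : M → ℝ}
    (hh : MDifferentiable 𝓘(ℝ, E) 𝓘(ℝ, ℝ) h) (h0 : ∀ x u, mvfderiv 𝓘(ℝ, E) h x u = 0) :
    ∃ c, ∀ x, h x = c := by
  have hloc : IsLocallyConstant h := by
    rw [IsLocallyConstant.iff_eventually_eq]
    intro x
    obtain ⟨r, hr, hball⟩ := Metric.mem_nhds_iff.1 (extChartAt_target_mem_nhds (I := 𝓘(ℝ, E)) x)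
    have hd : ∀ z ∈ Metric.ball (extChartAt 𝓘(ℝ, E) x x) r,
        HasFDerivAt (fun z ↦ h ((extChartAt 𝓘(ℝ, E) x).symm z)) (0 : E →L[ℝ] ℝ) z := by
      intro z hz
      have h1 := ((contMDiffAt_extChartAt_symm x (hball hz)).mdifferentiableAt
        (by simp)).hasMFDerivAt
      have h2 := ((hh _).hasMFDerivAt.comp z h1).hasFDerivAt
      exact h2.congr_fderiv (ContinuousLinearMap.ext fun w ↦ h0 _ _)
    have hconst : ∀ z ∈ Metric.ball (extChartAt 𝓘(ℝ, E) x x) r,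
        h ((extChartAt 𝓘(ℝ, E) x).symm z) = h x := by
      intro z hz
      have := (convex_ball _ _).is_const_of_fderivWithin_eq_zero (𝕜 := ℝ)
        (fun w hw ↦ (hd w hw).differentiableAt.differentiableWithinAt)
        (fun w hw ↦ (hd w hw).hasFDerivWithinAt.fderivWithin (Metric.isOpen_ball.uniqueDiffOn w hw))
        hz (Metric.mem_ball_self hr)
      simpa using this
    filter_upwards [(continuousAt_extChartAt (I := 𝓘(ℝ, E)) x).preimage_mem_nhds
      (Metric.ball_mem_nhds _ hr), extChartAt_source_mem_nhds (I := 𝓘(ℝ, E)) x] with q hq hqs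
    have := hconst _ hq
    rwa [(extChartAt 𝓘(ℝ, E) x).left_inv hqs] at this
  exact ⟨_, fun x ↦ hloc.apply_eq_of_isPreconnected isPreconnected_univ (Set.mem_univ x)
    (Set.mem_univ (Classical.arbitrary M))⟩

variable [RiemannianBundle (fun x : M ↦ TangentSpace 𝓘(ℝ, E) x)]

/-- The metric in the chart at `x`, as a field of continuous bilinear forms. -/
def chartMetricForm (x : M) (z : E) : E →L[ℝ] E →L[ℝ] ℝ :=
  (innerSL ℝ : TangentSpace 𝓘(ℝ, E) ((extChartAt 𝓘(ℝ, E) x).symm z) →L[ℝ]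
    TangentSpace 𝓘(ℝ, E) ((extChartAt 𝓘(ℝ, E) x).symm z) →L[ℝ] ℝ).bilinearComp
    (mfderiv 𝓘(ℝ, E) 𝓘(ℝ, E) (extChartAt 𝓘(ℝ, E) x).symm z)
    (mfderiv 𝓘(ℝ, E) 𝓘(ℝ, E) (extChartAt 𝓘(ℝ, E) x).symm z)

theorem chartMetric_comm (x : M) (z u v : E) : chartMetric x z u v = chartMetric x z v u :=
  real_inner_comm _ _

theorem chartMetric_self (x : M) (u v : E) :
    chartMetric x (extChartAt 𝓘(ℝ, E) x x) u v = inner ℝ (E := TangentSpace 𝓘(ℝ, E) x) u v := by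
  rw [chartMetric, mfderiv_extChartAt_symm_self]
  have h : ∀ p, p = x → inner ℝ (E := TangentSpace 𝓘(ℝ, E) p) u v =
    inner ℝ (E := TangentSpace 𝓘(ℝ, E) x) u v := by rintro p rfl; rfl
  exact h _ (extChartAt_to_inv x)

theorem chartMetric_mfderiv_extChartAt (x : M) {p : M} (hp : p ∈ (extChartAt 𝓘(ℝ, E) x).source)
    (a b : TangentSpace 𝓘(ℝ, E) p) :
    chartMetric (E := E) x (extChartAt 𝓘(ℝ, E) x p)
      (mfderiv 𝓘(ℝ, E) 𝓘(ℝ, E) (extChartAt 𝓘(ℝ, E) x) p a)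
      (mfderiv 𝓘(ℝ, E) 𝓘(ℝ, E) (extChartAt 𝓘(ℝ, E) x) p b) = inner ℝ a b := by
  have h : ∀ q, q = p → ∀ a' b' : TangentSpace 𝓘(ℝ, E) q, (a' : E) = a → (b' : E) = b →
      inner ℝ a' b' = inner ℝ a b := by rintro q rfl _ _ rfl rfl; rfl
  exact h _ ((extChartAt 𝓘(ℝ, E) x).left_inv hp) _ _ (mfderiv_symm_mfderiv_extChartAt x hp a)
    (mfderiv_symm_mfderiv_extChartAt x hp b)

theorem chartMetric_chartField (x : M) (X Y : ∀ p : M, TangentSpace 𝓘(ℝ, E) p) {z : E}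
    (hz : z ∈ (extChartAt 𝓘(ℝ, E) x).target) :
    chartMetric x z (chartField x X z) (chartField x Y z) =
      inner ℝ (X ((extChartAt 𝓘(ℝ, E) x).symm z)) (Y ((extChartAt 𝓘(ℝ, E) x).symm z)) := by
  rw [chartMetric, mfderiv_symm_chartField x X hz, mfderiv_symm_chartField x Y hz]

theorem chartMetric_pos (x : M) {z : E} (hz : z ∈ (extChartAt 𝓘(ℝ, E) x).target) {u : E}
    (hu : u ≠ 0) : 0 < chartMetric x z u u := by
  rw [chartMetric, real_inner_self_pos]
  intro h
  exact hu (mfderiv_extChartAt_symm_injective x hz (h.trans (map_zero _).symm))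

variable [IsContMDiffRiemannianBundle 𝓘(ℝ, E) ∞ E (fun x : M ↦ TangentSpace 𝓘(ℝ, E) x)]

/-- It suffices to test on constant vectors `u`, `v`: their images under the differential of the
inverse chart vary smoothly, and the metric is smooth. -/
theorem contDiffOn_chartMetricForm (x : M) :
    ContDiffOn ℝ ∞ (chartMetricForm x) (extChartAt 𝓘(ℝ, E) x).target := by
  have : IsManifold 𝓘(ℝ, E) 1 M := .of_le (n := ∞) (by simp)
  rw [contDiffOn_clm_apply]
  intro u
  rw [contDiffOn_clm_apply]
  intro v
  rw [← contMDiffOn_iff_contDiffOn]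
  have hs (u : E) : ContMDiffOn 𝓘(ℝ, E) (𝓘(ℝ, E).prod 𝓘(ℝ, E)) ∞
      (fun z ↦ (⟨(extChartAt 𝓘(ℝ, E) x).symm z,
        mfderiv 𝓘(ℝ, E) 𝓘(ℝ, E) (extChartAt 𝓘(ℝ, E) x).symm z u⟩ : TangentBundle 𝓘(ℝ, E) M))
      (extChartAt 𝓘(ℝ, E) x).target := by
    have h := (contMDiffOn_extChartAt_symm (I := 𝓘(ℝ, E)) (n := ∞)
      x).contMDiffOn_tangentMapWithin (m := ∞) (by simp)
      (isOpen_extChartAt_target x).uniqueMDiffOn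
    have h2 : ContMDiff 𝓘(ℝ, E) (𝓘(ℝ, E).prod 𝓘(ℝ, E)) ∞
        (fun z ↦ (⟨z, u⟩ : TangentBundle 𝓘(ℝ, E) E)) :=
      contMDiff_vectorSpace_iff_contDiff.2 contDiff_const
    refine (h.comp h2.contMDiffOn fun z hz ↦ hz).congr fun z hz ↦ ?_
    simp only [Function.comp_apply, tangentMapWithin]
    rw [mfderivWithin_of_isOpen (isOpen_extChartAt_target x) hz]
  exact ContMDiffOn.inner_bundle (E := fun x : M ↦ TangentSpace 𝓘(ℝ, E) x) (hs u) (hs v)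

theorem differentiableAt_chartMetricForm (x : M) {z : E}
    (hz : z ∈ (extChartAt 𝓘(ℝ, E) x).target) : DifferentiableAt ℝ (chartMetricForm x) z :=
  ((contDiffOn_chartMetricForm x).contDiffAt
    ((isOpen_extChartAt_target x).mem_nhds hz)).differentiableAt (by simp)

theorem mvfderiv_inner_eq_fderiv_chart (x : M) (Y W : SmoothVectorField E M)
    (u : TangentSpace 𝓘(ℝ, E) x) :
    mvfderiv 𝓘(ℝ, E) (fun p ↦ inner ℝ (Y p) (W p)) x u =
      fderiv ℝ (fun z ↦ chartMetricForm x z (chartField x Y z) (chartField x W z))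
        (extChartAt 𝓘(ℝ, E) x x) u := by
  rw [mvfderiv_eq_fderiv_chart x (mdifferentiable_inner Y W x)]
  have h : (fun z ↦ inner ℝ (Y ((extChartAt 𝓘(ℝ, E) x).symm z))
      (W ((extChartAt 𝓘(ℝ, E) x).symm z))) =ᶠ[𝓝 (extChartAt 𝓘(ℝ, E) x x)]
      fun z ↦ chartMetricForm x z (chartField x Y z) (chartField x W z) := by
    filter_upwards [extChartAt_target_mem_nhds (I := 𝓘(ℝ, E)) x] with z hz
    exact (chartMetric_chartField x Y W hz).symm
  rw [h.fderiv_eq]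

/-- The Killing condition is pointwise, so each `x` may be treated at the centre of its own chart.
-/
theorem isKilling_of_satisfiesKillingEquationAt {X : SmoothVectorField E M}
    (h : ∀ x, SatisfiesKillingEquationAt (chartMetricForm x) (chartField x X)
      (extChartAt 𝓘(ℝ, E) x x)) : IsKilling X := by
  intro Y W x
  have hb (V : SmoothVectorField E M) : lieBracket ℝ (chartField x X) (chartField x V)
      (extChartAt 𝓘(ℝ, E) x x) = (⁅X, V⁆ x : E) :=
    (mlieBracket_eq_lieBracket_chartField x X V).symm
  have key := (h x).fderiv_apply
    (differentiableAt_chartMetricForm x (mem_extChartAt_target x))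
    (differentiableAt_chartField x Y) (differentiableAt_chartField x W)
  rw [hb, hb, chartField_self, chartField_self, chartField_self] at key
  exact (mvfderiv_inner_eq_fderiv_chart x Y W _).trans (key.trans
    (congrArg₂ (· + ·) (chartMetric_self x _ _) (chartMetric_self x _ _)))

end Chart

/-! ### Velocity fields of one-parameter families of maps. -/

section Flow

set_option maxSynthPendingDepth 3
set_option linter.unusedSectionVars false

variable {E : Type*} [NormedAddCommGroup E] [NormedSpace ℝ E] [FiniteDimensional ℝ E]
  {M : Type*} [TopologicalSpace M] [ChartedSpace E M] [IsManifold 𝓘(ℝ, E) ∞ M]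

variable (E) in
/-- The velocity at time `0` of a one-parameter family of maps of `M`, which is the identity
at time `0`. -/
def velocityField (F : ℝ × M → M) (m : M) : TangentSpace 𝓘(ℝ, E) m :=
  (mfderiv (𝓘(ℝ, ℝ).prod 𝓘(ℝ, E)) 𝓘(ℝ, E) F (0, m) ((1 : ℝ), (0 : E)) :
    TangentSpace 𝓘(ℝ, E) (F (0, m)))

/-- The field is the tangent map of `F` composed with the smooth map sending `m` to the vector `(1,
0)` at `(0, m)`. -/
theorem contMDiff_velocityField {F : ℝ × M → M}
    (hF : ContMDiff (𝓘(ℝ, ℝ).prod 𝓘(ℝ, E)) 𝓘(ℝ, E) ∞ F) (h0 : ∀ m, F (0, m) = m) :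
    ContMDiff 𝓘(ℝ, E) (𝓘(ℝ, E).prod 𝓘(ℝ, E)) ∞
      (fun m ↦ (⟨m, velocityField E F m⟩ : TangentBundle 𝓘(ℝ, E) M)) := by
  have : IsManifold 𝓘(ℝ, E) 1 M := .of_le (n := ∞) (by simp)
  have h1 : ContMDiff 𝓘(ℝ, E) (𝓘(ℝ, ℝ).tangent.prod 𝓘(ℝ, E).tangent) ∞
      (fun m : M ↦ ((⟨0, (1 : ℝ)⟩ : TangentBundle 𝓘(ℝ, ℝ) ℝ),
        (⟨m, (0 : E)⟩ : TangentBundle 𝓘(ℝ, E) M))) :=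
    contMDiff_const.prodMk (Bundle.contMDiff_zeroSection ℝ (TangentSpace 𝓘(ℝ, E) : M → Type _))
  have h2 := (hF.contMDiff_tangentMap (m := ∞) (by simp)).comp
    (contMDiff_equivTangentBundleProd_symm.comp h1)
  have h : ∀ (m q : M) (u : E), q = m → (⟨m, u⟩ : TangentBundle 𝓘(ℝ, E) M) = ⟨q, u⟩ := by
    rintro m q u rfl; rfl
  exact h2.congr fun m ↦ h m _ _ (h0 m)

theorem hasDerivAt_chart_flow (x : M) {F : ℝ × M → M}
    (hF : ContMDiff (𝓘(ℝ, ℝ).prod 𝓘(ℝ, E)) 𝓘(ℝ, E) ∞ F) (h0 : ∀ m, F (0, m) = m) {p : M}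
    (hp : p ∈ (extChartAt 𝓘(ℝ, E) x).source) :
    HasDerivAt (fun t ↦ extChartAt 𝓘(ℝ, E) x (F (t, p)))
      (chartField x (velocityField E F) (extChartAt 𝓘(ℝ, E) x p)) 0 := by
  have : IsManifold 𝓘(ℝ, E) 1 M := .of_le (n := ∞) (by simp)
  have h1 : HasMFDerivAt 𝓘(ℝ, ℝ) (𝓘(ℝ, ℝ).prod 𝓘(ℝ, E)) (fun t : ℝ ↦ (t, p)) 0
      ((ContinuousLinearMap.id ℝ ℝ).prod (0 : ℝ →L[ℝ] E)) :=
    (hasMFDerivAt_id (0 : ℝ)).prodMk (hasMFDerivAt_const p (0 : ℝ))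
  have h2 := (hF.mdifferentiable (by simp) (0, p)).hasMFDerivAt
  have h3 := (mdifferentiableAt_extChartAt (I := 𝓘(ℝ, E)) (x := x) (y := F (0, p))
    (by rw [h0]; simpa using hp)).hasMFDerivAt
  have h4 : HasFDerivAt (𝕜 := ℝ) (E := ℝ) (F := E) (fun t ↦ extChartAt 𝓘(ℝ, E) x (F (t, p))) _ 0 :=
    (h3.comp (0 : ℝ) (h2.comp (0 : ℝ) h1)).hasFDerivAt
  have h : ∀ q, q = p → ∀ u : E, (mfderiv 𝓘(ℝ, E) 𝓘(ℝ, E) (extChartAt 𝓘(ℝ, E) x) p u : E) =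
    mfderiv 𝓘(ℝ, E) 𝓘(ℝ, E) (extChartAt 𝓘(ℝ, E) x) q u := by rintro q rfl u; rfl
  rw [(chartField_eq_mfderiv x (velocityField E F) hp).trans (h _ (h0 p) _)]
  exact h4.hasDerivAt

/-- A one-parameter family of maps, read in the chart at `x`. -/
def chartFlow (x : M) (F : ℝ × M → M) (p : ℝ × E) : E :=
  extChartAt 𝓘(ℝ, E) x (F (p.1, (extChartAt 𝓘(ℝ, E) x).symm p.2))

theorem contDiffAt_chartFlow (x : M) {F : ℝ × M → M}
    (hF : ContMDiff (𝓘(ℝ, ℝ).prod 𝓘(ℝ, E)) 𝓘(ℝ, E) ∞ F) {t : ℝ} {z : E}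
    (hz : z ∈ (extChartAt 𝓘(ℝ, E) x).target)
    (hFz : F (t, (extChartAt 𝓘(ℝ, E) x).symm z) ∈ (extChartAt 𝓘(ℝ, E) x).source) :
    ContDiffAt ℝ ∞ (chartFlow x F) (t, z) := by
  rw [← contMDiffAt_iff_contDiffAt]
  have h1 : ContMDiffAt 𝓘(ℝ, ℝ × E) 𝓘(ℝ, E) ∞
      (fun p : ℝ × E ↦ (extChartAt 𝓘(ℝ, E) x).symm p.2) (t, z) :=
    ContMDiffAt.comp (t, z) (f := fun p : ℝ × E ↦ p.2) (contMDiffAt_extChartAt_symm x hz)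
      contDiff_snd.contMDiff.contMDiffAt
  have h2 : ContMDiffAt 𝓘(ℝ, ℝ × E) (𝓘(ℝ, ℝ).prod 𝓘(ℝ, E)) ∞
      (fun p : ℝ × E ↦ (p.1, (extChartAt 𝓘(ℝ, E) x).symm p.2)) (t, z) :=
    ContMDiffAt.prodMk contDiff_fst.contMDiff.contMDiffAt h1
  have h3 : ContMDiffAt 𝓘(ℝ, ℝ × E) 𝓘(ℝ, E) ∞
      (fun p : ℝ × E ↦ F (p.1, (extChartAt 𝓘(ℝ, E) x).symm p.2)) (t, z) :=
    ContMDiffAt.comp (t, z) (hF.contMDiffAt) h2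
  exact ContMDiffAt.comp (t, z) (contMDiffAt_extChartAt' (by simpa using hFz)) h3

theorem flowVelocity_chartFlow (x : M) {F : ℝ × M → M}
    (hF : ContMDiff (𝓘(ℝ, ℝ).prod 𝓘(ℝ, E)) 𝓘(ℝ, E) ∞ F) (h0 : ∀ m, F (0, m) = m) {z : E}
    (hz : z ∈ (extChartAt 𝓘(ℝ, E) x).target) :
    flowVelocity (chartFlow x F) z = chartField x (velocityField E F) z := by
  have hs := (extChartAt 𝓘(ℝ, E) x).map_target hz
  have hd := (contDiffAt_chartFlow x hF (t := 0) hz (by rwa [h0])).differentiableAt (by simp)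
  have h3 : HasDerivAt (fun t : ℝ ↦ (t, z)) ((1 : ℝ), (0 : E)) 0 :=
    (hasDerivAt_id (0 : ℝ)).prodMk (hasDerivAt_const 0 z)
  have h4 : HasDerivAt (fun t : ℝ ↦ chartFlow x F (t, z)) (flowVelocity (chartFlow x F) z) 0 :=
    HasFDerivAt.comp_hasDerivAt (0 : ℝ) (f := fun t : ℝ ↦ (t, z)) hd.hasFDerivAt h3
  have h5 := hasDerivAt_chart_flow x hF h0 hs
  rw [(extChartAt 𝓘(ℝ, E) x).right_inv hz] at h5
  exact h4.unique h5

variable [RiemannianBundle (fun x : M ↦ TangentSpace 𝓘(ℝ, E) x)]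

/-- The spatial differential factors as inverse chart, `φ t`, chart; the outer two maps intertwine
the chart metric with `g`, and `φ t` is an isometry. -/
theorem chartMetric_chartFlow (x : M) {φ : ℝ → (M ≃ₘ⟮𝓘(ℝ, E), 𝓘(ℝ, E)⟯ M)}
    (hφ : IsOneParameterIsometryGroup φ) {t : ℝ} {z : E}
    (hz : z ∈ (extChartAt 𝓘(ℝ, E) x).target)
    (hFz : φ t ((extChartAt 𝓘(ℝ, E) x).symm z) ∈ (extChartAt 𝓘(ℝ, E) x).source) (u v : E) :
    chartMetric x (chartFlow x (fun p : ℝ × M ↦ φ p.1 p.2) (t, z))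
      (fderiv ℝ (chartFlow x (fun p : ℝ × M ↦ φ p.1 p.2)) (t, z) (0, u))
      (fderiv ℝ (chartFlow x (fun p : ℝ × M ↦ φ p.1 p.2)) (t, z) (0, v)) =
    chartMetric x z u v := by
  have : IsManifold 𝓘(ℝ, E) 1 M := .of_le (n := ∞) (by simp)
  have hd := (contDiffAt_chartFlow x hφ.contMDiff (t := t) hz hFz).differentiableAt (by simp)
  have h1 : HasFDerivAt (fun z : E ↦ (t, z)) (ContinuousLinearMap.inr ℝ ℝ E) z :=
    hasFDerivAt_prodMk_right t z
  have h2 := HasFDerivAt.comp z (f := fun z : E ↦ (t, z)) hd.hasFDerivAt h1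
  have h3 := ((contMDiffAt_extChartAt_symm x hz).mdifferentiableAt (by simp)).hasMFDerivAt
  have h4 := ((φ t).contMDiff.mdifferentiable (by simp)
    ((extChartAt 𝓘(ℝ, E) x).symm z)).hasMFDerivAt
  have h5 := (mdifferentiableAt_extChartAt (I := 𝓘(ℝ, E)) (x := x)
    (y := φ t ((extChartAt 𝓘(ℝ, E) x).symm z)) (by simpa using hFz)).hasMFDerivAt
  have h6 := (h5.comp z (h4.comp z h3)).hasFDerivAt
  have h7 (w : E) : fderiv ℝ (chartFlow x (fun p : ℝ × M ↦ φ p.1 p.2)) (t, z) (0, w) =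
      mfderiv 𝓘(ℝ, E) 𝓘(ℝ, E) (extChartAt 𝓘(ℝ, E) x) (φ t ((extChartAt 𝓘(ℝ, E) x).symm z))
        (mfderiv 𝓘(ℝ, E) 𝓘(ℝ, E) (φ t) ((extChartAt 𝓘(ℝ, E) x).symm z)
          (mfderiv 𝓘(ℝ, E) 𝓘(ℝ, E) (extChartAt 𝓘(ℝ, E) x).symm z w)) := by
    have := congrArg (fun A : E →L[ℝ] E ↦ A w) (h2.unique h6)
    simpa using! this
  rw [h7, h7]
  refine (chartMetric_mfderiv_extChartAt x hFz _ _).trans ?_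
  exact hφ.isometry t _ _ _

end Flow

/-! ### Killing fields from geodesics, and the critical-length argument. -/

section GeodesicOrbit

set_option maxSynthPendingDepth 3
set_option linter.unusedSectionVars false

variable {E : Type*} [NormedAddCommGroup E] [NormedSpace ℝ E] [FiniteDimensional ℝ E]
  {M : Type*} [TopologicalSpace M] [ChartedSpace E M] [IsManifold 𝓘(ℝ, E) ∞ M]
  [RiemannianBundle (fun x : M ↦ TangentSpace 𝓘(ℝ, E) x)]

/-- The infinitesimal generator of a one-parameter group of isometries. -/
def IsOneParameterIsometryGroup.generator {φ : ℝ → (M ≃ₘ⟮𝓘(ℝ, E), 𝓘(ℝ, E)⟯ M)}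
    (hφ : IsOneParameterIsometryGroup φ) : SmoothVectorField E M :=
  ⟨velocityField E (fun p : ℝ × M ↦ φ p.1 p.2), contMDiff_velocityField hφ.contMDiff hφ.map_zero⟩

theorem IsOneParameterIsometryGroup.flowVelocity_chartFlow
    {φ : ℝ → (M ≃ₘ⟮𝓘(ℝ, E), 𝓘(ℝ, E)⟯ M)} (hφ : IsOneParameterIsometryGroup φ) (x : M) {z : E}
    (hz : z ∈ (extChartAt 𝓘(ℝ, E) x).target) :
    flowVelocity (chartFlow x (fun p : ℝ × M ↦ φ p.1 p.2)) z = chartField x hφ.generator z :=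
  GOManifold.flowVelocity_chartFlow x hφ.contMDiff hφ.map_zero hz

theorem IsOneParameterIsometryGroup.eventually_mem_source
    {φ : ℝ → (M ≃ₘ⟮𝓘(ℝ, E), 𝓘(ℝ, E)⟯ M)} (hφ : IsOneParameterIsometryGroup φ) (x : M) :
    ∀ᶠ t in 𝓝 (0 : ℝ), φ t x ∈ (extChartAt 𝓘(ℝ, E) x).source := by
  have hc : Continuous fun t ↦ φ t x :=
    hφ.contMDiff.continuous.comp (Continuous.prodMk_left x)
  refine hc.continuousAt ?_
  rw [hφ.map_zero]
  exact extChartAt_source_mem_nhds x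

/-- An orbit of a one-parameter group of isometries, read in a chart, is an integral curve of the
generator. -/
theorem IsOneParameterIsometryGroup.hasDerivAt_extChartAt
    {φ : ℝ → (M ≃ₘ⟮𝓘(ℝ, E), 𝓘(ℝ, E)⟯ M)} (hφ : IsOneParameterIsometryGroup φ) (x p : M) {s : ℝ}
    (hs : φ s p ∈ (extChartAt 𝓘(ℝ, E) x).source) :
    HasDerivAt (fun t ↦ extChartAt 𝓘(ℝ, E) x (φ t p))
      (chartField x hφ.generator (extChartAt 𝓘(ℝ, E) x (φ s p))) s := by
  have h := hasDerivAt_chart_flow x hφ.contMDiff hφ.map_zero hs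
  -- The group law writes `φ t p` as `φ (t - s) (φ s p)`, which reduces time `s` to time `0`.
  have h' : HasDerivAt (fun t ↦ extChartAt 𝓘(ℝ, E) x (φ t (φ s p)))
      (chartField x hφ.generator (extChartAt 𝓘(ℝ, E) x (φ s p))) (s - s) := by
    rw [sub_self]; exact h
  have h2 := h'.comp_sub_const s s
  simpa only [← hφ.map_add, sub_add_cancel] using h2

variable [IsContMDiffRiemannianBundle 𝓘(ℝ, E) ∞ E (fun x : M ↦ TangentSpace 𝓘(ℝ, E) x)]

theorem IsOneParameterIsometryGroup.satisfiesKillingEquationAt_generator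
    {φ : ℝ → (M ≃ₘ⟮𝓘(ℝ, E), 𝓘(ℝ, E)⟯ M)} (hφ : IsOneParameterIsometryGroup φ) (x : M) :
    SatisfiesKillingEquationAt (chartMetricForm x) (chartField x hφ.generator)
      (extChartAt 𝓘(ℝ, E) x x) := by
  have hy := mem_extChartAt_target (I := 𝓘(ℝ, E)) x
  have hΦ : ContDiffAt ℝ 2 (chartFlow x (fun p : ℝ × M ↦ φ p.1 p.2))
      (0, extChartAt 𝓘(ℝ, E) x x) :=
    (contDiffAt_chartFlow x hφ.contMDiff hy
      (by rw [hφ.map_zero, extChartAt_to_inv]; exact mem_extChartAt_source x)).of_le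
      (WithTop.coe_le_coe.2 le_top)
  have h := satisfiesKillingEquationAt_flowVelocity
    (differentiableAt_chartMetricForm x hy) hΦ ?_ ?_
  · have he : flowVelocity (chartFlow x (fun p : ℝ × M ↦ φ p.1 p.2)) =ᶠ[𝓝 (extChartAt 𝓘(ℝ, E) x x)]
        chartField x hφ.generator := by
      filter_upwards [extChartAt_target_mem_nhds (I := 𝓘(ℝ, E)) x] with z hz
      exact hφ.flowVelocity_chartFlow x hz
    rw [SatisfiesKillingEquationAt, he.fderiv_eq, he.eq_of_nhds] at h
    exact h
  · filter_upwards [extChartAt_target_mem_nhds (I := 𝓘(ℝ, E)) x] with z hz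
    simp only [chartFlow, hφ.map_zero]
    exact (extChartAt 𝓘(ℝ, E) x).right_inv hz
  · filter_upwards [hφ.eventually_mem_source x] with t ht u v
    exact chartMetric_chartFlow x hφ hy (by rwa [extChartAt_to_inv]) u v

theorem IsOneParameterIsometryGroup.isKilling_generator
    {φ : ℝ → (M ≃ₘ⟮𝓘(ℝ, E), 𝓘(ℝ, E)⟯ M)} (hφ : IsOneParameterIsometryGroup φ) :
    IsKilling hφ.generator :=
  isKilling_of_satisfiesKillingEquationAt hφ.satisfiesKillingEquationAt_generator

theorem chartChristoffel_eq (x : M) {y : E} (hy : y ∈ (extChartAt 𝓘(ℝ, E) x).target) (u v w : E) :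
    chartChristoffel x y u v w = (fderiv ℝ (chartMetricForm x) y u v w
      + fderiv ℝ (chartMetricForm x) y v u w - fderiv ℝ (chartMetricForm x) y w u v) / 2 := by
  have h (a b c : E) : fderiv ℝ (fun z ↦ chartMetric x z a b) y c =
      fderiv ℝ (chartMetricForm x) y c a b := by
    have := fderiv_bilin_apply (differentiableAt_chartMetricForm x hy)
      (differentiableAt_const a) (differentiableAt_const b) c
    simpa using! this
  rw [chartChristoffel, h, h, h]

theorem satisfiesGeodesicEquationInChart_iff (x : M) (γ : ℝ → M) (t : ℝ)
    (ht : γ t ∈ (extChartAt 𝓘(ℝ, E) x).source) :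
    SatisfiesGeodesicEquationInChart E x γ t ↔
      SatisfiesGeodesicEquationAt (chartMetricForm x) (extChartAt 𝓘(ℝ, E) x (γ t))
        (deriv (fun s ↦ extChartAt 𝓘(ℝ, E) x (γ s)) t)
        (deriv (deriv (fun s ↦ extChartAt 𝓘(ℝ, E) x (γ s))) t) := by
  refine forall_congr' fun w ↦ ?_
  rw [chartChristoffel_eq x ((extChartAt 𝓘(ℝ, E) x).map_source ht)]
  rfl

/-- Local existence of geodesics with a given initial velocity. -/
theorem exists_isGeodesicOn (x : M) (v : E) :
    ∃ ε > 0, ∃ γ : ℝ → M, γ 0 = x ∧ IsGeodesicOn E γ (Set.Ioo (-ε) ε) ∧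
      deriv (fun s ↦ extChartAt 𝓘(ℝ, E) x (γ s)) 0 = v ∧
      SatisfiesGeodesicEquationInChart E x γ 0 := by
  obtain ⟨ε, hε, c, hc0, hcd, hcT, hcs, hgeo⟩ := exists_geodesic_in_coordinates
    (isOpen_extChartAt_target (I := 𝓘(ℝ, E)) x) (contDiffOn_chartMetricForm x)
    (fun z hz u hu ↦ chartMetric_pos x hz hu) (mem_extChartAt_target x) v
  have h0 : (0 : ℝ) ∈ Set.Ioo (-ε) ε := ⟨by linarith, hε⟩
  have hs : ∀ t ∈ Set.Ioo (-ε) ε,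
      (extChartAt 𝓘(ℝ, E) x).symm (c t) ∈ (extChartAt 𝓘(ℝ, E) x).source :=
    fun t ht ↦ (extChartAt 𝓘(ℝ, E) x).map_target (hcT ht)
  have he : ∀ t ∈ Set.Ioo (-ε) ε,
      (fun s ↦ extChartAt 𝓘(ℝ, E) x ((extChartAt 𝓘(ℝ, E) x).symm (c s))) =ᶠ[𝓝 t] c := by
    intro t ht
    filter_upwards [isOpen_Ioo.mem_nhds ht] with s hs
    exact (extChartAt 𝓘(ℝ, E) x).right_inv (hcT hs)
  have hgeo' : ∀ t ∈ Set.Ioo (-ε) ε, SatisfiesGeodesicEquationInChart E x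
      (fun s ↦ (extChartAt 𝓘(ℝ, E) x).symm (c s)) t := by
    intro t ht
    rw [satisfiesGeodesicEquationInChart_iff x _ t (hs t ht), (he t ht).deriv_eq,
      (he t ht).deriv.deriv_eq, (extChartAt 𝓘(ℝ, E) x).right_inv (hcT ht)]
    exact hgeo t ht
  -- `IsGeodesicOn` supplies the equation only in some chart; recording it in the chart at `x`
  -- avoids a proof of chart independence.
  refine ⟨ε, hε, fun s ↦ (extChartAt 𝓘(ℝ, E) x).symm (c s), ?_, ⟨?_, fun t ht ↦
    ⟨x, by simpa using hs t ht, hgeo' t ht⟩⟩, ?_, hgeo' 0 h0⟩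
  · simp [hc0]
  · exact ((contMDiffOn_extChartAt_symm x).of_le (m := 2) (WithTop.coe_le_coe.2 le_top)).comp
      hcs.contMDiffOn hcT
  · rw [(he 0 h0).deriv_eq, hcd]

/-- On a geodesic orbit manifold, every tangent vector is the value of a Killing field whose
length is critical at the base point. -/
theorem IsGeodesicOrbitManifold.exists_isKilling (hGO : IsGeodesicOrbitManifold E M) (x : M)
    (v : TangentSpace 𝓘(ℝ, E) x) :
    ∃ Z : SmoothVectorField E M, IsKilling Z ∧ Z x = v ∧
      ∀ u : TangentSpace 𝓘(ℝ, E) x, mvfderiv 𝓘(ℝ, E) (fun p ↦ inner ℝ (Z p) (Z p)) x u = 0 := by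
  obtain ⟨ε, hε, γ, hγ0, hγ, hγv, hgeo⟩ := exists_isGeodesicOn (E := E) x v
  have h0 : (0 : ℝ) ∈ Set.Ioo (-ε) ε := ⟨by linarith, hε⟩
  obtain ⟨φ, hφ, p, hp⟩ := hGO γ _ isOpen_Ioo Set.ordConnected_Ioo hγ
  obtain rfl : x = p := by rw [← hγ0, hp 0 h0, hφ.map_zero]
  have hc : (fun s ↦ extChartAt 𝓘(ℝ, E) x (γ s)) =ᶠ[𝓝 0]
      fun s ↦ extChartAt 𝓘(ℝ, E) x (φ s x) := by
    filter_upwards [isOpen_Ioo.mem_nhds h0] with s hs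
    rw [hp s hs]
  have hd : deriv (fun s ↦ extChartAt 𝓘(ℝ, E) x (φ s x)) =ᶠ[𝓝 0]
      fun s ↦ chartField x hφ.generator (extChartAt 𝓘(ℝ, E) x (φ s x)) := by
    filter_upwards [hφ.eventually_mem_source x] with s hs
    exact (hφ.hasDerivAt_extChartAt x x hs).deriv
  have hZd := differentiableAt_chartField x hφ.generator
  have hd0 : deriv (fun s ↦ extChartAt 𝓘(ℝ, E) x (γ s)) 0 =
      chartField x hφ.generator (extChartAt 𝓘(ℝ, E) x x) := by
    rw [hc.deriv_eq, hd.eq_of_nhds, hφ.map_zero]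
  -- The orbit satisfies `c' = Z(c)` near `0`, whence `c'' = DZ(c') = DZ(Z)`.
  have hdd0 : deriv (deriv (fun s ↦ extChartAt 𝓘(ℝ, E) x (γ s))) 0 =
      fderiv ℝ (chartField x hφ.generator) (extChartAt 𝓘(ℝ, E) x x)
        (chartField x hφ.generator (extChartAt 𝓘(ℝ, E) x x)) := by
    rw [hc.deriv.deriv_eq, hd.deriv_eq]
    have h1 := hφ.hasDerivAt_extChartAt x x (hφ.eventually_mem_source x).self_of_nhds
    have h2 : HasFDerivAt (chartField x hφ.generator)
        (fderiv ℝ (chartField x hφ.generator) (extChartAt 𝓘(ℝ, E) x x))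
        (extChartAt 𝓘(ℝ, E) x (φ 0 x)) := by
      rw [hφ.map_zero]; exact hZd.hasFDerivAt
    exact (h2.comp_hasDerivAt (0 : ℝ) h1).deriv.trans (by rw [hφ.map_zero])
  refine ⟨hφ.generator, hφ.isKilling_generator, ?_, fun u ↦ ?_⟩
  · exact (chartField_self x hφ.generator).symm.trans (hd0.symm.trans hγv)
  · rw [mvfderiv_inner_eq_fderiv_chart]
    rw [satisfiesGeodesicEquationInChart_iff x γ 0 (by rw [hγ0]; exact mem_extChartAt_source x),
      hγ0, hd0, hdd0] at hgeo
    exact (hφ.satisfiesKillingEquationAt_generator x).fderiv_apply_self_eq_zero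
      (differentiableAt_chartMetricForm x (mem_extChartAt_target x)) hZd
      (chartMetric_comm x _) hgeo u

/-- The derivative of the squared length of a Killing field `X` along a Killing field `Y`. -/
theorem IsKilling.inner_lie_self_eq_zero {X Y : SmoothVectorField E M} (hY : IsKilling Y) {x : M}
    (h : mvfderiv 𝓘(ℝ, E) (fun p ↦ inner ℝ (X p) (X p)) x (Y x) = 0) :
    inner ℝ (⁅Y, X⁆ x) (X x) = 0 := by
  have h1 := hY X X x
  rw [h, real_inner_comm (⁅Y, X⁆ x) (X x)] at h1
  linarith

/-- At a zero of `W` the derivative term of the Killing equation vanishes, so bracketing with `W` is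
skew-symmetric there. -/
theorem IsKilling.inner_lie_add_inner_lie_eq_zero {W : SmoothVectorField E M} (hW : IsKilling W)
    {x : M} (h : W x = 0) (Y X : SmoothVectorField E M) :
    inner ℝ (⁅W, Y⁆ x) (X x) + inner ℝ (Y x) (⁅W, X⁆ x) = 0 := by
  rw [← hW Y X x, h, map_zero]

/-- A Killing field in an abelian ideal of the Killing algebra of a geodesic orbit manifold has
critical length everywhere. -/
theorem IsGeodesicOrbitManifold.mvfderiv_inner_self_eq_zero (hGO : IsGeodesicOrbitManifold E M)
    (𝔞 : LieIdeal ℝ (killingAlgebra E M)) (h𝔞 : IsLieAbelian 𝔞) (X : killingAlgebra E M)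
    (hX : X ∈ 𝔞) (x : M) (u : TangentSpace 𝓘(ℝ, E) x) :
    mvfderiv 𝓘(ℝ, E) (fun p ↦ inner ℝ ((X : SmoothVectorField E M) p)
      ((X : SmoothVectorField E M) p)) x u = 0 := by
  obtain ⟨X, hXK⟩ := X
  obtain ⟨Z, hZK, hZx, hZ⟩ := hGO.exists_isKilling x (X x)
  have hWK : IsKilling (Z - X) := (killingAlgebra E M).sub_mem hZK hXK
  have hW0 : (Z - X) x = 0 := sub_eq_zero.2 hZx
  -- Criticality of `|Z|²` combined with skew-symmetry of `W = Z - X` at `x`.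
  have hdec (Y : SmoothVectorField E M) (hY : IsKilling Y) :
      inner ℝ (⁅Y, X⁆ x) (X x) + inner ℝ (Y x) (⁅Z - X, X⁆ x) = 0 := by
    have h1 := hY.inner_lie_self_eq_zero (hZ (Y x))
    have h2 := hWK.inner_lie_add_inner_lie_eq_zero hW0 Y X
    have h3 : ⁅Y, Z⁆ x = ⁅Y, X⁆ x - ⁅Z - X, Y⁆ x := by
      have : ⁅Y, Z⁆ = ⁅Y, X⁆ - ⁅Z - X, Y⁆ := by rw [← lie_skew (Z - X) Y, lie_sub]; abel
      rw [this]; rfl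
    rw [h3, hZx, inner_sub_left] at h1
    linarith
  have hWX : ⁅Z - X, X⁆ x = 0 := by
    have hmem : ⁅(⟨Z - X, hWK⟩ : killingAlgebra E M), (⟨X, hXK⟩ : killingAlgebra E M)⁆ ∈ 𝔞 :=
      lie_mem_right ℝ _ 𝔞 _ _ hX
    have hab : ⁅⁅Z - X, X⁆, X⁆ = 0 := by
      have := h𝔞.trivial ⟨_, hmem⟩ ⟨_, hX⟩
      exact congrArg (fun Y : 𝔞 ↦ ((Y : killingAlgebra E M) : SmoothVectorField E M)) this
    -- The choice `Y = [W, X]` kills the first term, because the ideal is abelian, and turns the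
    -- second into a squared norm.
    have h := hdec ⁅Z - X, X⁆ (hWK.lie hXK)
    rw [hab] at h
    have h' : inner ℝ (⁅Z - X, X⁆ x) (⁅Z - X, X⁆ x) = 0 := by simpa using h
    exact inner_self_eq_zero.1 h'
  -- Second use of the geodesic orbit property: the arbitrary direction `u` is the value of a
  -- Killing field.
  obtain ⟨Y, hYK, rfl, -⟩ := hGO.exists_isKilling x u
  have h := hdec Y hYK
  rw [hWX, inner_zero_right, add_zero] at h
  refine (hYK X X x).trans ?_
  rw [real_inner_comm (⁅Y, X⁆ x) (X x), h, add_zero]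

end GeodesicOrbit

end GOManifold

end

/-- Every Killing field in an abelian ideal of the Lie algebra of Killing fields of a geodesic orbit
manifold has constant length. -/
theorem theorem1
    {E : Type*} [NormedAddCommGroup E] [NormedSpace ℝ E] [FiniteDimensional ℝ E]
    {M : Type*} [TopologicalSpace M] [T2Space M] [SecondCountableTopology M] [ConnectedSpace M]
    [ChartedSpace E M] [IsManifold 𝓘(ℝ, E) ∞ M]
    [RiemannianBundle (fun x : M ↦ TangentSpace 𝓘(ℝ, E) x)]
    [IsContMDiffRiemannianBundle 𝓘(ℝ, E) ∞ E (fun x : M ↦ TangentSpace 𝓘(ℝ, E) x)]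
    (hGO : GOManifold.IsGeodesicOrbitManifold E M)
    (𝔞 : LieIdeal ℝ (GOManifold.killingAlgebra E M)) (h𝔞 : IsLieAbelian 𝔞)
    (X : GOManifold.killingAlgebra E M) (hX : X ∈ 𝔞) :
    ∃ c : ℝ, ∀ x : M, ‖(X : GOManifold.SmoothVectorField E M) x‖ = c := by
  obtain ⟨c, hc⟩ := GOManifold.exists_eq_const_of_mvfderiv_eq_zero
    (GOManifold.mdifferentiable_inner (X : GOManifold.SmoothVectorField E M) X)
    (hGO.mvfderiv_inner_self_eq_zero 𝔞 h𝔞 X hX)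
  exact ⟨√c, fun x ↦ by rw [norm_eq_sqrt_real_inner, hc]⟩
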